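/- For a nonempty face $F$ of a polyhedron $P\subseteq\mathbb R^d$ (that is, the nonempty set of maximizers over $P$ of some linear functional; $F=P$ is allowed) let $\mathcal N_P(F)=\{y\in\mathbb R^d : \langle y,x\rangle\ge\langle y,x'\rangle\ \forall x\in F,\ \forall x'\in P\}$ be its normal cone, let $\mathcal N(P)=\{\mathcal N_P(F) : F \text{ a nonempty face of } P\}$ be the normal fan of $P$, and for $C\subseteq\mathbb R^d$ let $\mathcal N(P)|_C=\{\mathcal N_P(F)\cap C : F\text{ a nonempty face of }P\}$. Let $P,Q\subset\mathbb R^d$ be polytopes, let $C\subseteq\mathbb R^d$ be a closed polyhedral cone with nonempty interior, let $C^\circ=\{x : \langle y,x\rangle\le 0\ \forall y\in C\}$ be its polar cone, and let $\tilde P=P+C^\circ$ and $\tilde Q=Q+C^\circ$ (Minkowski sums). (i) If $\mathcal N(P)|_C=\mathcal N(Q)|_C$, then $\mathcal N(\tilde P)=\mathcal N(\tilde Q)$. (ii) Conversely, suppose that neither $P$ nor $Q$ has a dominated vertex, i.e. for every vertex $v$ of $P$ there is $y\in C$ with $\langle y,v\rangle>\langle y,w\rangle$ for all vertices $w\ne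 v$ of $P$, and likewise for $Q$. If $\mathcal N(\tilde P)=\mathcal N(\tilde Q)$, then $\mathcal N(P)|_C=\mathcal N(Q)|_C$. -/

import Mathlib

open scoped Pointwise

/-- A polytope in `ℝ^d`: the convex hull of a finite set of points. -/
def IsPolytope {d : ℕ} (P : Set (EuclideanSpace ℝ (Fin d))) : Prop :=
  ∃ S : Set (EuclideanSpace ℝ (Fin d)), S.Finite ∧ P = convexHull ℝ S

/-- A polyhedral cone in `ℝ^d`: a finite intersection of closed linear half-spaces
(such a set is automatically closed). -/
def IsPolyhedralCone {d : ℕ} (C : Set (EuclideanSpace ℝ (Fin d))) : Prop :=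
  ∃ S : Set (EuclideanSpace ℝ (Fin d)), S.Finite ∧ C = {y | ∀ a ∈ S, inner ℝ a y ≤ 0}

/-- The polar cone `C° = {x | ⟨y, x⟩ ≤ 0 for all y ∈ C}`. -/
def polarCone {d : ℕ} (C : Set (EuclideanSpace ℝ (Fin d))) : Set (EuclideanSpace ℝ (Fin d)) :=
  {x | ∀ y ∈ C, inner ℝ y x ≤ 0}

/-- `F` is a (nonempty) face of the polyhedron `P`: the nonempty set of maximizers over `P` of some
linear functional. The zero functional gives the face `F = P`. -/
def IsFaceOf {d : ℕ} (P F : Set (EuclideanSpace ℝ (Fin d))) : Prop :=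
  F.Nonempty ∧ IsExposed ℝ P F

/-- The normal cone `N_P(F)`: all `y` such that every point of `F` maximizes `⟨y, ·⟩` over `P`. -/
def polyNormalCone {d : ℕ} (P F : Set (EuclideanSpace ℝ (Fin d))) :
    Set (EuclideanSpace ℝ (Fin d)) :=
  {y | ∀ x ∈ F, ∀ x' ∈ P, inner ℝ y x' ≤ inner ℝ y x}

/-- The normal fan `N(P)`: the set of the normal cones of all faces of `P`. -/
def normalFan {d : ℕ} (P : Set (EuclideanSpace ℝ (Fin d))) :
    Set (Set (EuclideanSpace ℝ (Fin d))) :=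
  {K | ∃ F, IsFaceOf P F ∧ K = polyNormalCone P F}

/-- The restriction `N(P)|_C`: the set of all `N_P(F) ∩ C` with `F` a face of `P`. -/
def restrictedNormalFan {d : ℕ} (P C : Set (EuclideanSpace ℝ (Fin d))) :
    Set (Set (EuclideanSpace ℝ (Fin d))) :=
  {K | ∃ F, IsFaceOf P F ∧ K = polyNormalCone P F ∩ C}

/-- `P` has no vertex that is dominated with respect to `C`: every vertex of `P` is the strict
maximizer, among the vertices of `P`, of `⟨y, ·⟩` for some direction `y ∈ C`. -/
def NoDominatedVertex {d : ℕ} (P C : Set (EuclideanSpace ℝ (Fin d))) : Prop :=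
  ∀ v ∈ P.extremePoints ℝ, ∃ y ∈ C,
    ∀ w ∈ P.extremePoints ℝ, w ≠ v → inner ℝ y w < inner ℝ y v

/-! Write P^y for the face of P where y is maximal (`maxFace`). Its normal cone is the least cone of
the fan containing y (`polyNormalCone_maxFace_subset`), so the fan determines it. For a nonempty
polytope P, the sum P + C° has a face in direction y exactly when y ∈ C, with cone N_P(P^y) ∩
N_{C°}((C°)^y) (`normalFan_add_polarCone`). The second factor lies in C, so only N_P(P^y) ∩ C
matters; this gives (i).

For y interior to C the second factor is all of C, so the fan of the sum determines N_P(P^y) ∩ C for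
such y. Without dominated vertices, interior directions single out every vertex. The cone of a face
of P is the intersection of its vertex cones, so its trace on C is an intersection of traces of
cones of Q; that is again in the restricted fan of Q
(`IsPolytope.polyNormalCone_inter_mem_restrictedNormalFan`), which gives (ii). -/

section NormalFan

variable {d : ℕ} {P Q C D A B F K : Set (EuclideanSpace ℝ (Fin d))}
  {x y z v : EuclideanSpace ℝ (Fin d)}

/-- The set of maximizers over `P` of the linear functional `⟨y, ·⟩`. -/
def maxFace (P : Set (EuclideanSpace ℝ (Fin d))) (y : EuclideanSpace ℝ (Fin d)) :
    Set (EuclideanSpace ℝ (Fin d)) :=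
  {x | x ∈ P ∧ ∀ x' ∈ P, inner ℝ y x' ≤ inner ℝ y x}

theorem maxFace_subset : maxFace P y ⊆ P := fun _ hx => hx.1

theorem isFaceOf_iff : IsFaceOf P F ↔ F.Nonempty ∧ ∃ y, F = maxFace P y := by
  refine and_congr_right fun hF => ⟨fun h => ?_, ?_⟩
  · obtain ⟨l, hl⟩ := h hF
    refine ⟨(InnerProductSpace.toDual ℝ _).symm l, ?_⟩
    rw [hl]
    ext x
    simp [maxFace, InnerProductSpace.toDual_symm_apply]
  · rintro ⟨y, hy⟩ _
    exact ⟨innerSL ℝ y, by rw [hy]; ext x; simp [maxFace]⟩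

theorem isFaceOf_maxFace (h : (maxFace P y).Nonempty) : IsFaceOf P (maxFace P y) :=
  isFaceOf_iff.2 ⟨h, y, rfl⟩

theorem isFaceOf_self (h : P.Nonempty) : IsFaceOf P P :=
  isFaceOf_iff.2 ⟨h, 0, by ext x; simp [maxFace]⟩

theorem IsFaceOf.polyhedron_nonempty (h : IsFaceOf P F) : P.Nonempty :=
  h.1.mono h.2.subset

theorem normalFan_nonempty_iff : (normalFan P).Nonempty ↔ P.Nonempty :=
  ⟨fun ⟨_, _, hF, _⟩ => hF.polyhedron_nonempty, fun h => ⟨_, P, isFaceOf_self h, rfl⟩⟩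

theorem restrictedNormalFan_nonempty_iff : (restrictedNormalFan P C).Nonempty ↔ P.Nonempty :=
  ⟨fun ⟨_, _, hF, _⟩ => hF.polyhedron_nonempty, fun h => ⟨_, P, isFaceOf_self h, rfl⟩⟩

theorem polyNormalCone_anti (h : A ⊆ B) : polyNormalCone P B ⊆ polyNormalCone P A :=
  fun _ hy x hx => hy x (h hx)

theorem mem_polyNormalCone_maxFace : y ∈ polyNormalCone P (maxFace P y) := fun _ hx => hx.2

theorem subset_maxFace (hA : A ⊆ P) (hy : y ∈ polyNormalCone P A) : A ⊆ maxFace P y :=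
  fun x hx => ⟨hA hx, hy x hx⟩

/-- The normal cone of the face in direction `y` is the least cone of the fan containing `y`. -/
theorem polyNormalCone_maxFace_subset (hA : A ⊆ P) (hy : y ∈ polyNormalCone P A) :
    polyNormalCone P (maxFace P y) ⊆ polyNormalCone P A :=
  polyNormalCone_anti (subset_maxFace hA hy)

theorem maxFace_add (hP : (maxFace P y).Nonempty) (hD : (maxFace D y).Nonempty) :
    maxFace (P + D) y = maxFace P y + maxFace D y := by
  obtain ⟨p₀, hp₀⟩ := hP
  obtain ⟨q₀, hq₀⟩ := hD
  ext x
  constructor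
  · rintro ⟨⟨p, hp, q, hq, rfl⟩, hmax⟩
    have h := hmax _ (Set.add_mem_add hp₀.1 hq₀.1)
    simp only [inner_add_right] at h
    have h₁ := hp₀.2 p hp
    have h₂ := hq₀.2 q hq
    exact Set.add_mem_add ⟨hp, fun p' hp' => by linarith [hp₀.2 p' hp']⟩
      ⟨hq, fun q' hq' => by linarith [hq₀.2 q' hq']⟩
  · rintro ⟨p, hp, q, hq, rfl⟩
    refine ⟨Set.add_mem_add hp.1 hq.1, ?_⟩
    rintro _ ⟨p', hp', q', hq', rfl⟩
    simp only [inner_add_right]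
    linarith [hp.2 p' hp', hq.2 q' hq']

theorem polyNormalCone_add (hA : A.Nonempty) (hAP : A ⊆ P) (hB : B.Nonempty) (hBD : B ⊆ D) :
    polyNormalCone (P + D) (A + B) = polyNormalCone P A ∩ polyNormalCone D B := by
  ext z
  constructor
  · intro hz
    constructor
    · intro a ha p hp
      obtain ⟨b, hb⟩ := hB
      simpa [inner_add_right] using
        hz _ (Set.add_mem_add ha hb) _ (Set.add_mem_add hp (hBD hb))
    · intro b hb q hq
      obtain ⟨a, ha⟩ := hA
      simpa [inner_add_right] using
        hz _ (Set.add_mem_add ha hb) _ (Set.add_mem_add (hAP ha) hq)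
  · rintro ⟨h₁, h₂⟩ _ ⟨a, ha, b, hb, rfl⟩ _ ⟨p, hp, q, hq, rfl⟩
    simp only [inner_add_right]
    linarith [h₁ a ha p hp, h₂ b hb q hq]

theorem polyNormalCone_maxFace_add (hP : (maxFace P y).Nonempty) (hD : (maxFace D y).Nonempty) :
    polyNormalCone (P + D) (maxFace (P + D) y) =
      polyNormalCone P (maxFace P y) ∩ polyNormalCone D (maxFace D y) := by
  rw [maxFace_add hP hD, polyNormalCone_add hP maxFace_subset hD maxFace_subset]

/-! ### The polar cone and its faces. -/

theorem zero_mem_polarCone : (0 : EuclideanSpace ℝ (Fin d)) ∈ polarCone C := by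
  simp [polarCone]

theorem add_mem_polarCone (hx : x ∈ polarCone C) (hy : y ∈ polarCone C) :
    x + y ∈ polarCone C := fun z hz => by
  rw [inner_add_right]
  linarith [hx z hz, hy z hz]

/-- The vectors `a` defining the half-spaces of `C` themselves lie in `C°`, so this half of the
bipolar theorem needs no separation argument. -/
theorem IsPolyhedralCone.mem_of_polar (hC : IsPolyhedralCone C)
    (hy : ∀ x ∈ polarCone C, inner ℝ y x ≤ 0) : y ∈ C := by
  obtain ⟨S, -, rfl⟩ := hC
  intro a ha
  rw [real_inner_comm]
  refine hy a fun z hz => ?_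
  rw [real_inner_comm]
  exact hz a ha

theorem IsPolyhedralCone.convex (hC : IsPolyhedralCone C) : Convex ℝ C := by
  obtain ⟨S, -, rfl⟩ := hC
  intro x hx y hy a b ha hb _ s hs
  rw [inner_add_right, inner_smul_right, inner_smul_right]
  nlinarith [hx s hs, hy s hs]

theorem IsPolyhedralCone.zero_mem (hC : IsPolyhedralCone C) : 0 ∈ C := by
  obtain ⟨S, -, rfl⟩ := hC
  simp

theorem zero_mem_maxFace_polarCone (hy : y ∈ C) : 0 ∈ maxFace (polarCone C) y :=
  ⟨zero_mem_polarCone, fun x hx => by simpa using hx y hy⟩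

/-- `C°` is closed under addition, so a maximizer `a` competes with `a + x` for every `x ∈ C°`; this
forces `⟨z, x⟩ ≤ 0`. -/
theorem IsPolyhedralCone.polyNormalCone_polarCone_subset (hC : IsPolyhedralCone C)
    (hA : A ⊆ polarCone C) (hA' : A.Nonempty) : polyNormalCone (polarCone C) A ⊆ C := by
  intro z hz
  obtain ⟨a, ha⟩ := hA'
  refine hC.mem_of_polar fun x hx => ?_
  have := hz a ha _ (add_mem_polarCone (hA ha) hx)
  rw [inner_add_right] at this
  linarith

theorem IsPolyhedralCone.mem_of_maxFace_add_nonempty (hC : IsPolyhedralCone C)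
    (h : (maxFace (P + polarCone C) y).Nonempty) : y ∈ C := by
  obtain ⟨_, ⟨p, hp, q, hq, rfl⟩, hmax⟩ := h
  refine hC.mem_of_polar fun x hx => ?_
  have := hmax _ (Set.add_mem_add hp (add_mem_polarCone hq hx))
  simp only [inner_add_right] at this
  linarith

/-- For small `t > 0` the point `y + t • x` is still in `C`, and pairing it with `x ∈ C°` leaves `t
* ‖x‖² ≤ 0`. -/
theorem eq_zero_of_inner_eq_zero_of_mem_interior (hy : y ∈ interior C) (hx : x ∈ polarCone C)
    (hxy : inner ℝ y x = 0) : x = 0 := by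
  have hc : Filter.Tendsto (fun t : ℝ => y + t • x) (nhdsWithin 0 (Set.Ioi 0)) (nhds y) := by
    have : Continuous fun t : ℝ => y + t • x := by fun_prop
    simpa using (this.tendsto 0).mono_left nhdsWithin_le_nhds
  obtain ⟨t, ht, ht0⟩ :=
    ((hc.eventually (mem_interior_iff_mem_nhds.1 hy)).and self_mem_nhdsWithin).exists
  have h := hx _ ht
  rw [inner_add_left, inner_smul_left, hxy, zero_add] at h
  have h' : inner ℝ x x ≤ 0 := by
    by_contra! hpos
    exact absurd h (not_le.2 (mul_pos ht0 hpos))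
  exact inner_self_eq_zero.1 (le_antisymm h' real_inner_self_nonneg)

theorem maxFace_polarCone_of_mem_interior (hy : y ∈ interior C) :
    maxFace (polarCone C) y = {0} := by
  refine Set.Subset.antisymm (fun x hx => ?_)
    (Set.singleton_subset_iff.2 (zero_mem_maxFace_polarCone (interior_subset hy)))
  refine eq_zero_of_inner_eq_zero_of_mem_interior hy hx.1 (le_antisymm ?_ ?_)
  · exact hx.1 y (interior_subset hy)
  · simpa using hx.2 0 zero_mem_polarCone

theorem IsPolyhedralCone.polyNormalCone_polarCone_of_mem_interior (hC : IsPolyhedralCone C)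
    (hy : y ∈ interior C) :
    polyNormalCone (polarCone C) (maxFace (polarCone C) y) = C := by
  refine Set.Subset.antisymm (hC.polyNormalCone_polarCone_subset maxFace_subset
    ⟨0, zero_mem_maxFace_polarCone (interior_subset hy)⟩) ?_
  rw [maxFace_polarCone_of_mem_interior hy]
  rintro z hz _ rfl x hx
  simpa using hx z hz

/-! ### Polytopes and part (i). -/

theorem IsPolytope.isCompact (hP : IsPolytope P) : IsCompact P := by
  obtain ⟨S, hS, rfl⟩ := hP
  exact hS.isCompact_convexHull ℝ

theorem IsPolytope.convex (hP : IsPolytope P) : Convex ℝ P := by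
  obtain ⟨S, -, rfl⟩ := hP
  exact convex_convexHull ℝ S

theorem IsPolytope.finite_extremePoints (hP : IsPolytope P) : (P.extremePoints ℝ).Finite := by
  obtain ⟨S, hS, rfl⟩ := hP
  exact hS.subset extremePoints_convexHull_subset

theorem IsPolytope.maxFace_nonempty (hP : IsPolytope P) (hne : P.Nonempty)
    (y : EuclideanSpace ℝ (Fin d)) : (maxFace P y).Nonempty := by
  obtain ⟨x, hx, hmax⟩ := hP.isCompact.exists_isMaxOn hne
    (f := fun x => inner ℝ y x) (by fun_prop)
  exact ⟨x, hx, fun x' hx' => hmax hx'⟩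

theorem normalFan_add_polarCone (hP : IsPolytope P) (hne : P.Nonempty)
    (hC : IsPolyhedralCone C) :
    normalFan (P + polarCone C) = {K | ∃ y ∈ C, K = polyNormalCone P (maxFace P y) ∩
      polyNormalCone (polarCone C) (maxFace (polarCone C) y)} := by
  ext K
  constructor
  · rintro ⟨F, hF, rfl⟩
    obtain ⟨hFne, y, rfl⟩ := isFaceOf_iff.1 hF
    have hy : y ∈ C := hC.mem_of_maxFace_add_nonempty hFne
    exact ⟨y, hy, polyNormalCone_maxFace_add (hP.maxFace_nonempty hne y)
      ⟨0, zero_mem_maxFace_polarCone hy⟩⟩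
  · rintro ⟨y, hy, rfl⟩
    have h₁ := hP.maxFace_nonempty hne y
    have h₂ : (maxFace (polarCone C) y).Nonempty := ⟨0, zero_mem_maxFace_polarCone hy⟩
    refine ⟨maxFace (P + polarCone C) y, isFaceOf_maxFace ?_,
      (polyNormalCone_maxFace_add h₁ h₂).symm⟩
    rw [maxFace_add h₁ h₂]
    exact h₁.add h₂

theorem polyNormalCone_maxFace_inter_subset (hQ : IsPolytope Q) (hQne : Q.Nonempty)
    (h : restrictedNormalFan P C = restrictedNormalFan Q C) (hy : y ∈ C) :
    polyNormalCone P (maxFace P y) ∩ C ⊆ polyNormalCone Q (maxFace Q y) ∩ C := by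
  have hmem : polyNormalCone Q (maxFace Q y) ∩ C ∈ restrictedNormalFan P C :=
    h ▸ ⟨_, isFaceOf_maxFace (hQ.maxFace_nonempty hQne y), rfl⟩
  obtain ⟨F, hF, hK⟩ := hmem
  have hyF : y ∈ polyNormalCone P F ∩ C := hK ▸ ⟨mem_polyNormalCone_maxFace, hy⟩
  rw [hK]
  exact Set.inter_subset_inter_left _ (polyNormalCone_maxFace_subset hF.2.subset hyF.1)

theorem polyNormalCone_maxFace_inter_eq (hP : IsPolytope P) (hPne : P.Nonempty)
    (hQ : IsPolytope Q) (hQne : Q.Nonempty)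
    (h : restrictedNormalFan P C = restrictedNormalFan Q C) (hy : y ∈ C) :
    polyNormalCone P (maxFace P y) ∩ C = polyNormalCone Q (maxFace Q y) ∩ C :=
  (polyNormalCone_maxFace_inter_subset hQ hQne h hy).antisymm
    (polyNormalCone_maxFace_inter_subset hP hPne h.symm hy)

theorem normalFan_add_polarCone_eq (hP : IsPolytope P) (hPne : P.Nonempty)
    (hQ : IsPolytope Q) (hQne : Q.Nonempty) (hC : IsPolyhedralCone C)
    (h : restrictedNormalFan P C = restrictedNormalFan Q C) :
    normalFan (P + polarCone C) = normalFan (Q + polarCone C) := by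
  rw [normalFan_add_polarCone hP hPne hC, normalFan_add_polarCone hQ hQne hC]
  ext K
  refine exists_congr fun y => and_congr_right fun hy => ?_
  have hD : polyNormalCone (polarCone C) (maxFace (polarCone C) y) ⊆ C :=
    hC.polyNormalCone_polarCone_subset maxFace_subset ⟨0, zero_mem_maxFace_polarCone hy⟩
  -- The polar factor absorbs an intersection with `C`, which can be moved onto the factors of `P`
  -- and `Q`.
  rw [← Set.inter_eq_right.2 hD, ← Set.inter_assoc, ← Set.inter_assoc,
    polyNormalCone_maxFace_inter_eq hP hPne hQ hQne h hy]

/-! ### Part (ii): directions interior to the cone. -/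

theorem polyNormalCone_maxFace_inter_subset_of_mem_interior (hP : IsPolytope P)
    (hPne : P.Nonempty) (hQ : IsPolytope Q) (hQne : Q.Nonempty) (hC : IsPolyhedralCone C)
    (h : normalFan (P + polarCone C) = normalFan (Q + polarCone C)) (hy : y ∈ interior C) :
    polyNormalCone P (maxFace P y) ∩ C ⊆ polyNormalCone Q (maxFace Q y) ∩ C := by
  have hyC := interior_subset hy
  have hD := hC.polyNormalCone_polarCone_of_mem_interior hy
  have h₀ : (maxFace (polarCone C) y).Nonempty := ⟨0, zero_mem_maxFace_polarCone hyC⟩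
  have hmem : polyNormalCone Q (maxFace Q y) ∩ C ∈ normalFan (P + polarCone C) := by
    rw [h, normalFan_add_polarCone hQ hQne hC]
    exact ⟨y, hyC, by rw [hD]⟩
  obtain ⟨F, hF, hK⟩ := hmem
  have hyF : y ∈ polyNormalCone (P + polarCone C) F :=
    hK ▸ ⟨mem_polyNormalCone_maxFace, hyC⟩
  have := polyNormalCone_maxFace_subset hF.2.subset hyF
  rwa [polyNormalCone_maxFace_add (hP.maxFace_nonempty hPne y) h₀, hD, ← hK] at this

theorem polyNormalCone_maxFace_inter_eq_of_mem_interior (hP : IsPolytope P)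
    (hPne : P.Nonempty) (hQ : IsPolytope Q) (hQne : Q.Nonempty) (hC : IsPolyhedralCone C)
    (h : normalFan (P + polarCone C) = normalFan (Q + polarCone C)) (hy : y ∈ interior C) :
    polyNormalCone P (maxFace P y) ∩ C = polyNormalCone Q (maxFace Q y) ∩ C :=
  (polyNormalCone_maxFace_inter_subset_of_mem_interior hP hPne hQ hQne hC h hy).antisymm
    (polyNormalCone_maxFace_inter_subset_of_mem_interior hQ hQne hP hPne hC h.symm hy)

/-! ### Part (ii): vertices and faces of a polytope. -/

theorem isClosed_convex_superlevel (z : EuclideanSpace ℝ (Fin d)) (c : ℝ) :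
    IsClosed {x : EuclideanSpace ℝ (Fin d) | c ≤ inner ℝ z x} ∧
      Convex ℝ {x : EuclideanSpace ℝ (Fin d) | c ≤ inner ℝ z x} :=
  ⟨isClosed_le continuous_const (by fun_prop),
    convex_halfSpace_ge (innerSL ℝ z).isLinear c⟩

/-- A face of a polytope is the closed convex hull of the vertices of the polytope it contains. -/
theorem IsPolytope.closure_convexHull_face (hP : IsPolytope P) (hF : IsFaceOf P F) :
    F ⊆ closure (convexHull ℝ (P.extremePoints ℝ ∩ F)) := by
  have hFc : IsCompact F := hF.2.isCompact hP.isCompact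
  have := closure_convexHull_extremePoints hFc (hF.2.convex hP.convex)
  conv_lhs => rw [← this]
  refine closure_mono (convexHull_mono fun v hv => ⟨?_, hv.1⟩)
  exact hF.2.isExtreme.extremePoints_subset_extremePoints hv

/-- A linear lower bound valid at the vertices of `F` passes to their closed convex hull. -/
theorem IsPolytope.polyNormalCone_face_eq (hP : IsPolytope P) (hF : IsFaceOf P F) :
    polyNormalCone P F = polyNormalCone P (P.extremePoints ℝ ∩ F) := by
  refine (polyNormalCone_anti Set.inter_subset_right).antisymm fun z hz x hx x' hx' => ?_
  obtain ⟨hcl, hcv⟩ := isClosed_convex_superlevel z (inner ℝ z x')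
  exact closure_minimal (convexHull_min (fun v hv => hz v hv x' hx') hcv) hcl
    (hP.closure_convexHull_face hF hx)

theorem IsPolytope.maxFace_eq_singleton (hP : IsPolytope P) (hv : v ∈ P.extremePoints ℝ)
    (hy : ∀ w ∈ P.extremePoints ℝ, w ≠ v → inner ℝ y w < inner ℝ y v) :
    maxFace P y = {v} := by
  have hne : (maxFace P y).Nonempty := hP.maxFace_nonempty ⟨v, hv.1⟩ y
  have hsub : maxFace P y ⊆ {v} := by
    refine (hP.closure_convexHull_face (isFaceOf_maxFace hne)).trans ?_
    refine closure_minimal (convexHull_min ?_ (convex_singleton v)) isClosed_singleton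
    rintro w ⟨hw, hwm⟩
    by_contra hwv
    exact absurd (hwm.2 v hv.1) (not_le.2 (hy w hw hwv))
  exact hne.subset_singleton_iff.1 hsub

/-- The direction witnessing non-domination may lie on the boundary of `C`. Finitely many strict
inequalities persist nearby, and `C` lies in the closure of its interior. -/
theorem IsPolytope.exists_mem_interior_maxFace_eq_singleton (hP : IsPolytope P)
    (hC : IsPolyhedralCone C) (hCfull : (interior C).Nonempty) (hdom : NoDominatedVertex P C)
    (hv : v ∈ P.extremePoints ℝ) : ∃ y ∈ interior C, maxFace P y = {v} := by
  obtain ⟨y, hyC, hy⟩ := hdom v hv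
  have hopen : ∀ᶠ u in nhds y, ∀ w ∈ P.extremePoints ℝ, w ≠ v → inner ℝ u w < inner ℝ u v := by
    rw [Filter.eventually_all_finite hP.finite_extremePoints]
    intro w hw
    by_cases hwv : w = v
    · exact Filter.Eventually.of_forall fun _ h => absurd hwv h
    · have : IsOpen {u : EuclideanSpace ℝ (Fin d) | inner ℝ u w < inner ℝ u v} :=
        isOpen_lt (by fun_prop) (by fun_prop)
      filter_upwards [this.mem_nhds (hy w hw hwv)] with u hu _ using hu
  have hycl : y ∈ closure (interior C) := by
    rw [hC.convex.closure_interior_eq_closure_of_nonempty_interior hCfull]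
    exact subset_closure hyC
  obtain ⟨u, hu, huC⟩ := mem_closure_iff_nhds.1 hycl _ hopen
  exact ⟨u, huC, hP.maxFace_eq_singleton hv hu⟩

/-- Points of the intrinsic interior admit a small extension of every segment beyond them. -/
theorem exists_pos_add_smul_sub_mem (hy : y ∈ intrinsicInterior ℝ K) (hz : z ∈ K) :
    ∃ t : ℝ, 0 < t ∧ y + t • (y - z) ∈ K := by
  obtain ⟨y', hy', rfl⟩ := mem_intrinsicInterior.1 hy
  -- The line is parametrized inside the affine span, where the intrinsic interior is an ordinary
  -- interior; parameter `-t` runs from `y` away from `z`.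
  let g : ℝ → affineSpan ℝ K := fun t =>
    ⟨AffineMap.lineMap (y' : EuclideanSpace ℝ (Fin d)) z (-t),
      AffineMap.lineMap_mem _ y'.2 (subset_affineSpan ℝ K hz)⟩
  have hg : Continuous g := by
    refine Continuous.subtype_mk ?_ _
    simp only [AffineMap.lineMap_apply]
    simp only [vsub_eq_sub, vadd_eq_add]
    fun_prop
  have hg0 : g 0 = y' := by ext1; simp [g]
  have hc : Filter.Tendsto g (nhdsWithin 0 (Set.Ioi 0)) (nhds y') := by
    simpa only [hg0] using (hg.tendsto 0).mono_left nhdsWithin_le_nhds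
  obtain ⟨t, ht, ht0⟩ :=
    ((hc.eventually (mem_interior_iff_mem_nhds.1 hy')).and self_mem_nhdsWithin).exists
  refine ⟨t, ht0, ?_⟩
  have ht' : (g t : EuclideanSpace ℝ (Fin d)) ∈ K := ht
  have : (g t : EuclideanSpace ℝ (Fin d)) = y' + t • ((y' : EuclideanSpace ℝ (Fin d)) - z) := by
    simp only [g, AffineMap.lineMap_apply, vsub_eq_sub, vadd_eq_add]
    module
  rwa [this] at ht'

theorem convex_polyNormalCone : Convex ℝ (polyNormalCone P A) := by
  intro y hy z hz a b ha hb _ x hx x' hx'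
  simp only [inner_add_left, real_inner_smul_left]
  nlinarith [mul_le_mul_of_nonneg_left (hy x hx x' hx') ha,
    mul_le_mul_of_nonneg_left (hz x hx x' hx') hb]

/-- The trace on `C` of the normal cone of any nonempty subset of a polytope belongs to the
restricted normal fan. -/
theorem IsPolytope.polyNormalCone_inter_mem_restrictedNormalFan (hQ : IsPolytope Q)
    (hC : IsPolyhedralCone C) (hA : A.Nonempty) (hAQ : A ⊆ Q) :
    polyNormalCone Q A ∩ C ∈ restrictedNormalFan Q C := by
  have hne : (polyNormalCone Q A ∩ C).Nonempty :=
    ⟨0, fun x _ x' _ => by simp, hC.zero_mem⟩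
  -- A relative interior point `y` of the trace gives the required face `maxFace Q y`.
  obtain ⟨y, hy⟩ := (intrinsicInterior_nonempty (convex_polyNormalCone.inter hC.convex)).2 hne
  have hyA := (intrinsicInterior_subset hy).1
  refine ⟨maxFace Q y, isFaceOf_maxFace (hQ.maxFace_nonempty (hA.mono hAQ) y), ?_⟩
  refine Set.Subset.antisymm ?_
    (Set.inter_subset_inter_left _ (polyNormalCone_maxFace_subset hAQ hyA))
  rintro z ⟨hzA, hzC⟩
  refine ⟨fun x hx x' hx' => ?_, hzC⟩
  -- Both `a` and `x` maximize `y`, so the normal cone inequality at `y + t • (y - z)` reduces to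
  -- `⟨z, a⟩ ≤ ⟨z, x⟩`; hence `x` also maximizes `z`.
  obtain ⟨t, ht, hmem, -⟩ := exists_pos_add_smul_sub_mem hy ⟨hzA, hzC⟩
  obtain ⟨a, ha⟩ := hA
  have h₁ := hmem a ha x hx.1
  have h₂ := hx.2 a (hAQ ha)
  have h₃ := hyA a ha x hx.1
  have h₄ := hzA a ha x' hx'
  simp only [inner_add_left, real_inner_smul_left, inner_sub_left] at h₁
  have h₅ : t * inner ℝ z a ≤ t * inner ℝ z x := by
    have : inner ℝ y x = inner ℝ y a := le_antisymm h₃ h₂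
    rw [this] at h₁
    linarith
  exact h₄.trans (le_of_mul_le_mul_left h₅ ht)

theorem restrictedNormalFan_subset (hP : IsPolytope P) (hPne : P.Nonempty)
    (hQ : IsPolytope Q) (hQne : Q.Nonempty) (hC : IsPolyhedralCone C)
    (hCfull : (interior C).Nonempty) (hdom : NoDominatedVertex P C)
    (h : normalFan (P + polarCone C) = normalFan (Q + polarCone C)) :
    restrictedNormalFan P C ⊆ restrictedNormalFan Q C := by
  rintro _ ⟨F, hF, rfl⟩
  choose! u huC hu using fun v (hv : v ∈ P.extremePoints ℝ) =>
    hP.exists_mem_interior_maxFace_eq_singleton hC hCfull hdom hv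
  have hVne : (P.extremePoints ℝ ∩ F).Nonempty := by
    by_contra hempty
    obtain ⟨x, hx⟩ := hF.1
    have := hP.closure_convexHull_face hF hx
    simp [Set.not_nonempty_iff_eq_empty.1 hempty] at this
  have hcone : ∀ v ∈ P.extremePoints ℝ,
      polyNormalCone P {v} ∩ C = polyNormalCone Q (maxFace Q (u v)) ∩ C := fun v hv => by
    rw [← hu v hv]
    exact polyNormalCone_maxFace_inter_eq_of_mem_interior hP hPne hQ hQne hC h (huC v hv)
  -- Intersecting vertex cones of `P` corresponds to taking the union of the matching faces of `Q`;
  -- this union need not be a face.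
  have heq : polyNormalCone P F ∩ C =
      polyNormalCone Q (⋃ v ∈ P.extremePoints ℝ ∩ F, maxFace Q (u v)) ∩ C := by
    rw [hP.polyNormalCone_face_eq hF]
    ext z
    refine and_congr_left fun hzC => ⟨fun hz x hx => ?_, fun hz v hv => ?_⟩
    · obtain ⟨v, hv, hxv⟩ := Set.mem_iUnion₂.1 hx
      have : z ∈ polyNormalCone P {v} ∩ C :=
        ⟨polyNormalCone_anti (Set.singleton_subset_iff.2 hv) hz, hzC⟩
      rw [hcone v hv.1] at this
      exact this.1 x hxv
    · have : z ∈ polyNormalCone Q (maxFace Q (u v)) ∩ C :=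
        ⟨fun x hx => hz x (Set.mem_iUnion₂.2 ⟨v, hv, hx⟩), hzC⟩
      rw [← hcone v hv.1] at this
      exact this.1 v rfl
  rw [heq]
  refine hQ.polyNormalCone_inter_mem_restrictedNormalFan hC ?_
    (Set.iUnion₂_subset fun _ _ => maxFace_subset)
  obtain ⟨v, hv⟩ := hVne
  obtain ⟨x, hx⟩ := hQ.maxFace_nonempty hQne (u v)
  exact ⟨x, Set.mem_iUnion₂.2 ⟨v, hv, hx⟩⟩

end NormalFan

theorem proposition1 {d : ℕ} (P Q C : Set (EuclideanSpace ℝ (Fin d)))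
    (hP : IsPolytope P) (hQ : IsPolytope Q)
    (hC : IsPolyhedralCone C) (hCfull : (interior C).Nonempty) :
    (restrictedNormalFan P C = restrictedNormalFan Q C →
      normalFan (P + polarCone C) = normalFan (Q + polarCone C)) ∧
    (NoDominatedVertex P C → NoDominatedVertex Q C →
      normalFan (P + polarCone C) = normalFan (Q + polarCone C) →
      restrictedNormalFan P C = restrictedNormalFan Q C) := by
  refine ⟨fun h => ?_, fun hdP hdQ h => ?_⟩
  -- Polytopes may be empty here; a fan is nonempty exactly when its polytope is, so `P` and `Q` are
  -- empty together.
  · have hiff : P.Nonempty ↔ Q.Nonempty := by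
      rw [← restrictedNormalFan_nonempty_iff (C := C), h, restrictedNormalFan_nonempty_iff]
    rcases P.eq_empty_or_nonempty with hPe | hPne
    · have hQe : Q = ∅ := Set.not_nonempty_iff_eq_empty.1 fun hQne => by simp_all
      rw [hPe, hQe]
    · exact normalFan_add_polarCone_eq hP hPne hQ (hiff.1 hPne) hC h
  · have hD : (polarCone C).Nonempty := ⟨0, zero_mem_polarCone⟩
    have hiff : P.Nonempty ↔ Q.Nonempty := by
      have := normalFan_nonempty_iff (P := P + polarCone C)
      rw [h, normalFan_nonempty_iff, Set.add_nonempty, Set.add_nonempty] at this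
      tauto
    rcases P.eq_empty_or_nonempty with hPe | hPne
    · have hQe : Q = ∅ := Set.not_nonempty_iff_eq_empty.1 fun hQne => by simp_all
      rw [hPe, hQe]
    · exact (restrictedNormalFan_subset hP hPne hQ (hiff.1 hPne) hC hCfull hdP h).antisymm
        (restrictedNormalFan_subset hQ (hiff.1 hPne) hP hPne hC hCfull hdQ h.symm)
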